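/- Let $\Gamma$ be a weighted digraph without loops on a finite vertex set $\{1,\dots,n\}$, with arc weights $\varepsilon_{ij}\ge 0$, where $\varepsilon_{ij}>0$ if there is an arc from $i$ to $j$ and $\varepsilon_{ij}=0$ otherwise. Its Kirchhoff matrix $L(\Gamma)=(\ell_{ij})$ is given by $\ell_{ij}=-\varepsilon_{ji}$ for $j\ne i$ and $\ell_{ii}=-\sum_{k\ne i}\ell_{ik}$. A spanning diverging forest of $\Gamma$ is a spanning subgraph without (directed) circuits in which every vertex has indegree at most $1$; its roots are its vertices of indegree $0$, and its weight is the product of the weights of its arcs (the empty product being $1$). The weight $\varepsilon(\mathcal S)$ of a set $\mathcal S$ of such forests is the sum of their weights. Let $v$ be the minimum number of roots of a spanning diverging forest of $\Gamma$; let $\mathcal F_{n-v}$ be the set of all spanning diverging forests with $n-v$ arcs (the maximum out forests), and $\mathcal F_{n-v}^{j\to i}$ the set of those in which $j$ is a root and $i$ is reachable from $j$. The normalized matrix of maximum out forests of $\Gamma$ is $$\bar J(\Gamma)=\frac{1}{\varepsilon(\mathcal F_{n-v})}\,\bigl(\varepsilon(\mathcal F_{n-v}^{j\to i})\bigr)_{i,j=1}^{n}.$$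 Let $P$ be the transition probability matrix (row-stochastic) of a finite time-homogeneous Markov chain with states $1,\dots,n$. (1) If the chain is related to $\Gamma$, i.e. $P=I-\alpha L(\Gamma)$ for some real $\alpha\ne 0$, then the limit $B=\lim_{k\to\infty}\frac1k\sum_{t=0}^{k-1}P^t$ exists and $B=\bar J(\Gamma)$. (2) Consequently, for every such $P$ the limit $B$ exists; for every $\alpha>0$ there is a weighted digraph $\Gamma$ with $L(\Gamma)=\alpha^{-1}(I-P)$, and $B=\bar J(\Gamma)$ for every such $\Gamma$. -/

import Mathlib

open Filter Topology

noncomputable section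

/-- A weighted digraph without loops: `weight i j` is the weight of the arc from `i` to `j`, and it
is zero iff there is no such arc; all arcs have strictly positive weight. -/
structure WeightedDigraph (V : Type*) where
  weight : V → V → ℝ
  weight_nonneg : ∀ i j, 0 ≤ weight i j
  weight_self : ∀ i, weight i i = 0

/-- `z` is joined to `w` by an arc of the arc set `F`. -/
def ArcIn {V : Type*} (F : Finset (V × V)) (z w : V) : Prop := (z, w) ∈ F

/-- `w` is reachable from `z` along the arcs of `F`; every vertex is reachable from itself. -/
def ReachableIn {V : Type*} (F : Finset (V × V)) (z w : V) : Prop :=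
  Relation.ReflTransGen (ArcIn F) z w

/-- The number of arcs of `F` that come in `w`. -/
def indegree {V : Type*} [DecidableEq V] (F : Finset (V × V)) (w : V) : ℕ :=
  (F.filter (fun e => e.2 = w)).card

/-- A spanning digraph with arc set `F` is a diverging forest if it has no circuits (no closed route
with at least one arc) and all indegrees are at most one. -/
def IsDivergingForest {V : Type*} [DecidableEq V] (F : Finset (V × V)) : Prop :=
  (∀ w, ¬ Relation.TransGen (ArcIn F) w w) ∧ ∀ w, indegree F w ≤ 1

/-- The roots of a forest: the vertices of indegree zero. -/
def forestRoots {V : Type*} [Fintype V] [DecidableEq V] (F : Finset (V × V)) : Finset V :=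
  Finset.univ.filter (fun w => indegree F w = 0)

namespace WeightedDigraph

variable {V : Type*} [Fintype V] [DecidableEq V]

/-- The Kirchhoff matrix: `ℓ i j = - ε j i` for `j ≠ i` and `ℓ i i = - ∑ k ≠ i, ℓ i k`. -/
def kirchhoff (Γ : WeightedDigraph V) : Matrix V V ℝ :=
  Matrix.of fun i j =>
    if j = i then ∑ k ∈ Finset.univ.erase i, Γ.weight k i else - Γ.weight j i

open Classical in
/-- The set of arcs. -/
def arcs (Γ : WeightedDigraph V) : Finset (V × V) :=
  Finset.univ.filter (fun e => Γ.weight e.1 e.2 ≠ 0)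

open Classical in
/-- The spanning diverging forests of `Γ`, each given by its arc set. -/
def forests (Γ : WeightedDigraph V) : Finset (Finset (V × V)) :=
  Γ.arcs.powerset.filter (fun F => IsDivergingForest F)

/-- The spanning diverging forests of `Γ` with `k` arcs. -/
def forestsCard (Γ : WeightedDigraph V) (k : ℕ) : Finset (Finset (V × V)) :=
  Γ.forests.filter (fun F => F.card = k)

open Classical in
/-- The spanning diverging forests of `Γ` with `k` arcs in which `j` belongs to a tree diverging
from `i`. -/
def forestsFromTo (Γ : WeightedDigraph V) (k : ℕ) (i j : V) : Finset (Finset (V × V)) :=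
  (Γ.forestsCard k).filter (fun F => i ∈ forestRoots F ∧ ReachableIn F i j)

/-- The weight of a spanning subgraph: the product of the weights of its arcs. -/
def subgraphWeight (Γ : WeightedDigraph V) (F : Finset (V × V)) : ℝ :=
  ∏ e ∈ F, Γ.weight e.1 e.2

/-- The weight of a set of spanning subgraphs: the sum of their weights. -/
def setWeight (Γ : WeightedDigraph V) (S : Finset (Finset (V × V))) : ℝ :=
  ∑ F ∈ S, Γ.subgraphWeight F

/-- The forest dimension `v`: the minimum possible number of roots of a spanning diverging forest. -/
def forestDimension (Γ : WeightedDigraph V) : ℕ :=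
  sInf {r : ℕ | ∃ F ∈ Γ.forests, (forestRoots F).card = r}

/-- The matrix `Q k` of spanning diverging forests with `k` arcs: its `i j` entry is the total weight
of those in which `i` belongs to a tree diverging from `j`. -/
def forestMatrix (Γ : WeightedDigraph V) (k : ℕ) : Matrix V V ℝ :=
  Matrix.of fun i j => Γ.setWeight (Γ.forestsFromTo k j i)

/-- The normalized matrix of maximum out forests. -/
def normalizedForestMatrix (Γ : WeightedDigraph V) : Matrix V V ℝ :=
  (Γ.setWeight (Γ.forestsCard (Fintype.card V - Γ.forestDimension)))⁻¹ •
    Γ.forestMatrix (Fintype.card V - Γ.forestDimension)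

/-- The Markov chain with transition matrix `P` is related to `Γ`. -/
def IsRelated (Γ : WeightedDigraph V) (P : Matrix V V ℝ) : Prop :=
  ∃ α : ℝ, α ≠ 0 ∧ P = 1 - α • Γ.kirchhoff

end WeightedDigraph

/-- `B` is the limiting matrix of average probabilities (the Cesàro limit of the powers of `P`). -/
def IsLimitingMatrix {V : Type*} [Fintype V] [DecidableEq V] (P B : Matrix V V ℝ) : Prop :=
  Tendsto (fun k : ℕ => (k : ℝ)⁻¹ • ∑ t ∈ Finset.range k, P ^ t) atTop (𝓝 B)

end

/-! Let `Q k` be the matrix of `k`-arc forests, `σ k` their total weight, `L` the Kirchhoff matrix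
and `J` the normalized matrix of maximum forests. Everything rests on the recurrence `Q (k+1) + L *
Q k = σ (k+1) • 1` (`forestMatrix_succ`). At the maximum `k` the terms of index `k + 1` vanish, so
`L * J = 0`; one index lower it gives `1 - J = L * X`. As `1 - P = α • L`, the matrix `J` is fixed
by `P` and `1 - J` lies in the column space of `1 - P`, so the averages of the powers telescope to
`J` (`isLimitingMatrix_of_eq`).

For row `i` of the recurrence, each forest is cut at the parent arc of `i`, leaving a forest `G`
rooted at `i` (`sum_divergingForests`). The identity then holds for each `G` separately. -/

/-- The sum of the indegrees is the number of arcs. -/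
theorem sum_indegree {V : Type*} [Fintype V] [DecidableEq V] (F : Finset (V × V)) :
    ∑ w, indegree F w = F.card :=
  (Finset.card_eq_sum_card_fiberwise (f := Prod.snd) (t := Finset.univ) (by simp)).symm

theorem ReachableIn.mono {V : Type*} {F G : Finset (V × V)} {j m : V} (h : G ⊆ F)
    (hr : ReachableIn G j m) : ReachableIn F j m :=
  Relation.ReflTransGen.mono (r := ArcIn G) (p := ArcIn F) (fun _ _ hab => h hab) _ _ hr

/-! ### Adding and removing an arc into a root -/

section Forest

variable {V : Type*} [DecidableEq V] {F G : Finset (V × V)} {i j p m : V}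

theorem indegree_eq_zero_iff : indegree F i = 0 ↔ ∀ z, (z, i) ∉ F := by
  simp only [indegree, Finset.card_eq_zero, Finset.filter_eq_empty_iff]
  constructor
  · intro h z hz
    exact h hz rfl
  · rintro h ⟨a, b⟩ hab rfl
    exact h a hab

theorem indegree_le_one_iff :
    indegree F i ≤ 1 ↔ ∀ y z, (y, i) ∈ F → (z, i) ∈ F → y = z := by
  simp only [indegree, Finset.card_le_one, Finset.mem_filter]
  constructor
  · intro h y z hy hz
    exact congrArg Prod.fst (h (y, i) ⟨hy, rfl⟩ (z, i) ⟨hz, rfl⟩)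
  · rintro h ⟨a, b⟩ ⟨hab, rfl⟩ ⟨c, d⟩ ⟨hcd, hd⟩
    simp only at hd
    subst hd
    rw [h a c hab hcd]

theorem reachableIn_insert_iff :
    ReachableIn (insert (p, i) G) j m ↔
      ReachableIn G j m ∨ (ReachableIn G j p ∧ ReachableIn G i m) := by
  have hsub : G ⊆ insert (p, i) G := Finset.subset_insert _ _
  constructor
  · intro h
    induction h with
    | refl => exact Or.inl .refl
    | tail _ hbc ih =>
      rcases Finset.mem_insert.1 hbc with h | h
      · obtain ⟨rfl, rfl⟩ := Prod.mk.inj h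
        rcases ih with ih | ih
        · exact Or.inr ⟨ih, .refl⟩
        · exact Or.inr ⟨ih.1, .refl⟩
      · exact ih.imp (fun ih => ih.tail h) (fun ih => ⟨ih.1, ih.2.tail h⟩)
  · rintro (h | ⟨h₁, h₂⟩)
    · exact h.mono hsub
    · exact ((h₁.mono hsub).tail (Finset.mem_insert_self _ _)).trans (h₂.mono hsub)

/-- A circuit through the new arc, cut at that arc, is a route from `i` to `p`. -/
theorem transGen_insert_self (h : Relation.TransGen (ArcIn (insert (p, i) G)) m m) :
    Relation.TransGen (ArcIn G) m m ∨ ReachableIn G i p := by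
  obtain ⟨b, hmb, hb⟩ := Relation.TransGen.tail'_iff.1 h
  replace hmb : ReachableIn (insert (p, i) G) m b := hmb
  rw [reachableIn_insert_iff] at hmb
  rcases Finset.mem_insert.1 hb with h | h
  · obtain ⟨rfl, rfl⟩ := Prod.mk.inj h
    rcases hmb with h | h
    · exact Or.inr h
    · exact Or.inr h.2
  · rcases hmb with h' | ⟨h₁, h₂⟩
    · exact Or.inl (Relation.TransGen.tail' h' h)
    · exact Or.inr ((h₂.tail h).trans h₁)

theorem IsDivergingForest.subset (hF : IsDivergingForest F) (h : G ⊆ F) : IsDivergingForest G :=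
  ⟨fun w hw => hF.1 w
      (Relation.TransGen.mono (r := ArcIn G) (p := ArcIn F) (fun _ _ hab => h hab) _ _ hw),
    fun w => (Finset.card_le_card (Finset.filter_subset_filter _ h)).trans (hF.2 w)⟩

/-- Adding an arc into a root `i` gives a forest if the arc does not start below `i`. -/
theorem IsDivergingForest.insert (hG : IsDivergingForest G) (hi : indegree G i = 0)
    (hp : ¬ ReachableIn G i p) : IsDivergingForest (insert (p, i) G) := by
  refine ⟨fun w hw => ?_, fun w => ?_⟩
  · rcases transGen_insert_self hw with h | h
    · exact hG.1 w h
    · exact hp h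
  · rw [indegree_eq_zero_iff] at hi
    have := indegree_le_one_iff.1 (hG.2 w)
    rw [indegree_le_one_iff]
    intro y z hy hz
    simp only [Finset.mem_insert, Prod.mk.injEq] at hy hz
    rcases hy with ⟨rfl, rfl⟩ | hy <;> rcases hz with ⟨rfl, h⟩ | hz
    · rfl
    · exact absurd hz (hi _)
    · subst h; exact absurd hy (hi _)
    · exact this y z hy hz

theorem indegree_insert_eq_zero_iff :
    indegree (insert (p, i) G) j = 0 ↔ j ≠ i ∧ indegree G j = 0 := by
  simp only [indegree_eq_zero_iff, Finset.mem_insert, Prod.mk.injEq, not_or, forall_and, ne_eq]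
  refine and_congr_left fun _ => ⟨fun h hji => h p ⟨rfl, hji⟩, fun h z hz => h hz.2⟩

/-- In a forest, the parent arc of a vertex can be removed. -/
theorem IsDivergingForest.erase_parent (hF : IsDivergingForest F) (h : (p, i) ∈ F) :
    IsDivergingForest (F.erase (p, i)) ∧ indegree (F.erase (p, i)) i = 0 ∧
      ¬ ReachableIn (F.erase (p, i)) i p := by
  refine ⟨hF.subset (Finset.erase_subset _ _), ?_, fun hr => ?_⟩
  · rw [indegree_eq_zero_iff]
    intro z hz
    obtain ⟨hne, hz⟩ := Finset.mem_erase.1 hz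
    exact hne (by rw [indegree_le_one_iff.1 (hF.2 i) z p hz h])
  · exact hF.1 i (Relation.TransGen.tail' (hr.mono (Finset.erase_subset _ _)) h)

theorem ReachableIn.eq_of_root (hi : indegree F i = 0) (h : ReachableIn F j i) : j = i := by
  rcases Relation.ReflTransGen.cases_tail h with h | ⟨b, _, hb⟩
  · exact h.symm
  · exact absurd hb (indegree_eq_zero_iff.1 hi b)

/-- Every vertex of a forest is reachable from at most one root. -/
theorem IsDivergingForest.root_unique (hF : IsDivergingForest F) (hi : indegree F i = 0)
    (hj : indegree F j = 0) (him : ReachableIn F i m) (hjm : ReachableIn F j m) : i = j := by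
  induction him with
  | refl => exact (hjm.eq_of_root hi).symm
  | @tail b c _ hbc ih =>
    rcases Relation.ReflTransGen.cases_tail hjm with h | ⟨d, hjd, hdc⟩
    · subst h
      exact absurd hbc (indegree_eq_zero_iff.1 hj b)
    · obtain rfl := indegree_le_one_iff.1 (hF.2 c) b d hbc hdc
      exact ih hjd

open Classical in
/-- The indicator of the event that `j` is a root of `F` from which `m` is reachable. -/
noncomputable def rootIndicator (F : Finset (V × V)) (m j : V) : ℝ :=
  if indegree F j = 0 ∧ ReachableIn F j m then 1 else 0

theorem rootIndicator_root_self (hi : indegree G i = 0) : rootIndicator G i i = 1 :=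
  if_pos ⟨hi, .refl⟩

theorem rootIndicator_root_ne (hi : indegree G i = 0) (hij : j ≠ i) : rootIndicator G i j = 0 :=
  if_neg fun h => hij (h.2.eq_of_root hi)

theorem rootIndicator_mul_of_ne (hG : IsDivergingForest G) (hij : i ≠ j) :
    rootIndicator G m i * rootIndicator G m j = 0 := by
  unfold rootIndicator
  split_ifs with h₁ h₂ <;> simp
  exact hij (hG.root_unique h₁.1 h₂.1 h₁.2 h₂.2)

theorem rootIndicator_insert_self : rootIndicator (insert (p, i) G) m i = 0 :=
  if_neg fun h => (indegree_insert_eq_zero_iff.1 h.1).1 rfl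

/-- New routes from `j` pass through `p` and then the old tree of `i`. The two events are disjoint,
since the distinct roots `i` and `j` cannot both reach `m`, so their indicators add. -/
theorem rootIndicator_insert_of_ne (hG : IsDivergingForest G) (hi : indegree G i = 0)
    (hij : j ≠ i) :
    rootIndicator (insert (p, i) G) m j =
      rootIndicator G m j + rootIndicator G m i * rootIndicator G p j := by
  classical
  have hiff : (indegree (insert (p, i) G) j = 0 ∧ ReachableIn (insert (p, i) G) j m) ↔
      indegree G j = 0 ∧ (ReachableIn G j m ∨ ReachableIn G j p ∧ ReachableIn G i m) := by
    rw [indegree_insert_eq_zero_iff, reachableIn_insert_iff, and_iff_right hij]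
  have hdisj : indegree G j = 0 → ReachableIn G j m → ¬ ReachableIn G i m := fun hj h₁ h₂ =>
    hij (hG.root_unique hj hi h₁ h₂)
  unfold rootIndicator
  rw [if_congr hiff rfl rfl]
  by_cases h₀ : indegree G j = 0 <;> by_cases h₁ : ReachableIn G j m <;>
    by_cases h₂ : ReachableIn G i m <;> by_cases h₃ : ReachableIn G j p <;>
    simp_all

end Forest

/-! ### Forest weights -/

namespace WeightedDigraph

/-- Lets sums range over all diverging forests on `V`, independently of the arcs of `Γ`. -/
theorem subgraphWeight_eq_zero {V : Type*} [Fintype V] (Γ : WeightedDigraph V)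
    {F : Finset (V × V)} (h : ¬ F ⊆ Γ.arcs) : Γ.subgraphWeight F = 0 := by
  obtain ⟨e, he, hne⟩ := Finset.not_subset.1 h
  simp only [arcs, Finset.mem_filter, Finset.mem_univ, true_and, not_not] at hne
  exact Finset.prod_eq_zero he hne

section WeightOfCard

variable {V : Type*} [DecidableEq V] (Γ : WeightedDigraph V)

/-- The weight of `F` if it has `k` arcs, and zero otherwise. -/
noncomputable def weightOfCard (k : ℕ) (F : Finset (V × V)) : ℝ :=
  if F.card = k then Γ.subgraphWeight F else 0

theorem weightOfCard_succ_insert {G : Finset (V × V)} {i : V} (hi : indegree G i = 0) (k : ℕ)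
    (p : V) : Γ.weightOfCard (k + 1) (insert (p, i) G) = Γ.weight p i * Γ.weightOfCard k G := by
  have hp := indegree_eq_zero_iff.1 hi p
  simp [weightOfCard, subgraphWeight, Finset.card_insert_of_notMem hp, Finset.prod_insert hp]

/-- Only the common factor `y`, independent of `p`, matters in the recurrence; this avoids treating
`k = 0` separately there. -/
theorem exists_weightOfCard_insert {G : Finset (V × V)} {i : V} (hi : indegree G i = 0) (k : ℕ) :
    ∃ y : ℝ, ∀ p, Γ.weightOfCard k (insert (p, i) G) = Γ.weight p i * y := by
  cases k with
  | zero => exact ⟨0, fun p => by simp [weightOfCard]⟩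
  | succ k => exact ⟨_, Γ.weightOfCard_succ_insert hi k⟩

end WeightOfCard

end WeightedDigraph

/-! ### Decomposition of forests at a vertex and the recurrence -/

section ForestSum

variable {V : Type*} [Fintype V] [DecidableEq V]

open Classical in
/-- All diverging forests on `V`. -/
noncomputable def divergingForests (V : Type*) [Fintype V] [DecidableEq V] :
    Finset (Finset (V × V)) :=
  Finset.univ.filter IsDivergingForest

/-- The diverging forests on `V` that have `i` among their roots. -/
noncomputable def divergingForestsWithRoot (i : V) : Finset (Finset (V × V)) :=
  (divergingForests V).filter (fun F => indegree F i = 0)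

theorem mem_divergingForests {F : Finset (V × V)} :
    F ∈ divergingForests V ↔ IsDivergingForest F := by
  simp [divergingForests]

theorem mem_divergingForestsWithRoot {F : Finset (V × V)} {i : V} :
    F ∈ divergingForestsWithRoot i ↔ IsDivergingForest F ∧ indegree F i = 0 := by
  simp [divergingForestsWithRoot, mem_divergingForests]

/-- Every forest arises from a unique forest `G` rooted at `i`, either as `G` itself or by adding an
arc into `i` that starts outside the tree of `i`. -/
theorem sum_divergingForests (i : V) (f : Finset (V × V) → ℝ) :
    ∑ F ∈ divergingForests V, f F =
      ∑ G ∈ divergingForestsWithRoot i,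
        (f G + ∑ p, (1 - rootIndicator G p i) * f (insert (p, i) G)) := by
  classical
  rw [Finset.sum_add_distrib,
    ← Finset.sum_filter_add_sum_filter_not _ (fun F => indegree F i = 0)]
  congr 1
  have h : ∀ G ∈ divergingForestsWithRoot i,
      ∑ p, (1 - rootIndicator G p i) * f (insert (p, i) G) =
        ∑ p ∈ Finset.univ.filter (fun p => ¬ ReachableIn G i p), f (insert (p, i) G) := by
    intro G hG
    rw [Finset.sum_filter]
    refine Finset.sum_congr rfl fun p _ => ?_
    by_cases hp : ReachableIn G i p <;>
      simp [rootIndicator, hp, (mem_divergingForestsWithRoot.1 hG).2]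
  rw [Finset.sum_congr rfl h, Finset.sum_sigma']
  symm
  refine Finset.sum_bij (fun x _ => insert (x.2, i) x.1) ?_ ?_ ?_ ?_
  · rintro ⟨G, p⟩ hx
    simp only [Finset.mem_sigma, mem_divergingForestsWithRoot, Finset.mem_filter,
      Finset.mem_univ, true_and] at hx
    simp only [Finset.mem_filter, mem_divergingForests, indegree_insert_eq_zero_iff]
    exact ⟨hx.1.1.insert hx.1.2 hx.2, fun h => h.1 rfl⟩
  · rintro ⟨G, p⟩ hx ⟨G', p'⟩ hx' heq
    simp only [Finset.mem_sigma, mem_divergingForestsWithRoot, Finset.mem_filter,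
      Finset.mem_univ, true_and, indegree_eq_zero_iff] at hx hx' heq
    have hp : p = p' := by
      have : (p, i) ∈ insert (p', i) G' := heq ▸ Finset.mem_insert_self _ _
      rcases Finset.mem_insert.1 this with h | h
      · exact congrArg Prod.fst h
      · exact absurd h (hx'.1.2 p)
    subst hp
    have hG : G = G' := by
      rw [← Finset.erase_insert (hx.1.2 p), heq, Finset.erase_insert (hx'.1.2 p)]
    rw [hG]
  · intro F hF
    simp only [Finset.mem_filter, mem_divergingForests, indegree_eq_zero_iff, not_forall,
      not_not] at hF
    obtain ⟨hF, p, hp⟩ := hF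
    obtain ⟨h₁, h₂, h₃⟩ := hF.erase_parent hp
    exact ⟨⟨F.erase (p, i), p⟩, by simp [mem_divergingForestsWithRoot, h₁, h₂, h₃],
      Finset.insert_erase hp⟩
  · intros; rfl

namespace WeightedDigraph

variable (Γ : WeightedDigraph V)

theorem setWeight_forestsCard (k : ℕ) :
    Γ.setWeight (Γ.forestsCard k) = ∑ F ∈ divergingForests V, Γ.weightOfCard k F := by
  classical
  simp only [setWeight, forestsCard, weightOfCard]
  rw [← Finset.sum_filter]
  refine Finset.sum_subset (fun F hF => ?_) (fun F hF hF' => Γ.subgraphWeight_eq_zero fun h => ?_)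
  · simp only [forests, Finset.mem_filter] at hF
    simp [mem_divergingForests, hF]
  · simp only [Finset.mem_filter, mem_divergingForests] at hF
    simp [forests, hF, h] at hF'

theorem forestMatrix_apply (k : ℕ) (i j : V) :
    Γ.forestMatrix k i j =
      ∑ F ∈ divergingForests V, Γ.weightOfCard k F * rootIndicator F i j := by
  classical
  simp only [forestMatrix, Matrix.of_apply, setWeight, forestsFromTo, forestsCard, weightOfCard,
    rootIndicator, mul_ite, mul_one, mul_zero]
  rw [← Finset.sum_filter, ← Finset.sum_filter]
  refine Finset.sum_subset (fun F hF => ?_) (fun F hF hF' => Γ.subgraphWeight_eq_zero fun h => ?_)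
  · simp only [forests, Finset.mem_filter, forestRoots, Finset.mem_univ, true_and] at hF
    simp [mem_divergingForests, hF]
  · simp only [Finset.mem_filter, mem_divergingForests] at hF
    simp [forests, forestRoots, hF, h] at hF'

theorem kirchhoff_mul_apply (A : Matrix V V ℝ) (i j : V) :
    (Γ.kirchhoff * A) i j = ∑ m, Γ.weight m i * A i j - ∑ m, Γ.weight m i * A m j := by
  have h : ∀ m, Γ.kirchhoff i m * A m j =
      (if m = i then (∑ k, Γ.weight k i) * A i j else 0) - Γ.weight m i * A m j := by
    intro m
    by_cases hm : m = i
    · subst hm; simp [kirchhoff, Γ.weight_self]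
    · simp [kirchhoff, hm]
  rw [Matrix.mul_apply, Finset.sum_congr rfl fun m _ => h m, Finset.sum_sub_distrib]
  simp [Finset.sum_mul]

/-- The recurrence for the matrices of forests. -/
theorem forestMatrix_succ (k : ℕ) :
    Γ.forestMatrix (k + 1) + Γ.kirchhoff * Γ.forestMatrix k =
      Γ.setWeight (Γ.forestsCard (k + 1)) • (1 : Matrix V V ℝ) := by
  ext i j
  rw [Matrix.add_apply, kirchhoff_mul_apply, Matrix.smul_apply, smul_eq_mul, ← Finset.sum_mul]
  simp only [forestMatrix_apply, setWeight_forestsCard]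
  simp only [sum_divergingForests i, Finset.mul_sum, Finset.sum_mul]
  rw [Finset.sum_comm (s := Finset.univ), ← Finset.sum_sub_distrib, ← Finset.sum_add_distrib]
  refine Finset.sum_congr rfl fun G hG => ?_
  obtain ⟨hG, hi⟩ := mem_divergingForestsWithRoot.1 hG
  obtain ⟨y, hy⟩ := Γ.exists_weightOfCard_insert hi k
  simp only [Γ.weightOfCard_succ_insert hi, hy]
  -- On the diagonal, forests with an arc into `i` contribute nothing to column `i`, and what
  -- remains counts the arcs into `i` from outside its tree.
  by_cases hij : j = i
  · subst hij
    simp only [rootIndicator_insert_self, rootIndicator_root_self hi, Matrix.one_apply_eq,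
      mul_zero, mul_one, Finset.sum_const_zero, add_zero]
    rw [← Finset.sum_sub_distrib]
    congr 1
    exact Finset.sum_congr rfl fun p _ => by ring
  · have hpj : ∀ p, rootIndicator G p i * rootIndicator G p j = 0 := fun p =>
      rootIndicator_mul_of_ne hG (Ne.symm hij)
    simp only [rootIndicator_insert_of_ne hG hi hij, rootIndicator_root_ne hi hij,
      rootIndicator_root_self hi, Matrix.one_apply_ne (Ne.symm hij)]
    have h₁ : ∀ c : ℝ, ∑ p, (1 - rootIndicator G p i) *
        (Γ.weight p i * c * (0 + 1 * rootIndicator G p j)) =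
          c * ∑ p, Γ.weight p i * rootIndicator G p j := fun c => by
      rw [Finset.mul_sum]
      exact Finset.sum_congr rfl fun p _ => by linear_combination (-Γ.weight p i * c) * hpj p
    have h₂ : ∀ m, ∑ p, (1 - rootIndicator G p i) * (Γ.weight p i * y *
        (rootIndicator G m j + rootIndicator G m i * rootIndicator G p j)) =
          y * ((∑ p, Γ.weight p i - ∑ p, Γ.weight p i * rootIndicator G p i) *
            rootIndicator G m j + (∑ p, Γ.weight p i * rootIndicator G p j) *
            rootIndicator G m i) := fun m => by
      rw [← Finset.sum_sub_distrib, Finset.sum_mul, Finset.sum_mul, ← Finset.sum_add_distrib,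
        Finset.mul_sum]
      exact Finset.sum_congr rfl fun p _ => by
        linear_combination (-Γ.weight p i * y * rootIndicator G m i) * hpj p
    simp only [h₁, h₂]
    -- `A`, `D` and `S` are the total weights into `i` from the tree of `j`, from the tree of `i`,
    -- and from all vertices; the entry is a polynomial identity in them.
    generalize hA : ∑ p, Γ.weight p i * rootIndicator G p j = A
    generalize hD : ∑ p, Γ.weight p i * rootIndicator G p i = D
    generalize hS : ∑ p, Γ.weight p i = S
    have h₃ : ∑ m, Γ.weight m i * (Γ.weightOfCard k G * rootIndicator G m j +
        y * ((S - D) * rootIndicator G m j + A * rootIndicator G m i)) =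
          (Γ.weightOfCard k G + y * (S - D)) * A + y * A * D := by
      rw [← hA, ← hD, Finset.mul_sum, Finset.mul_sum, ← Finset.sum_add_distrib, hA]
      exact Finset.sum_congr rfl fun p _ => by ring
    rw [h₃, ← Finset.sum_mul, hS]
    ring

/-! ### Maximum forests -/

theorem card_add_card_forestRoots {F : Finset (V × V)} (hF : IsDivergingForest F) :
    F.card + (forestRoots F).card = Fintype.card V := by
  rw [← sum_indegree, forestRoots, Finset.card_filter, ← Finset.sum_add_distrib,
    Finset.sum_congr rfl (g := fun _ => 1)]
  · simp
  · intro w _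
    have := hF.2 w
    split_ifs <;> omega

theorem isDivergingForest_of_mem_forests {F : Finset (V × V)} (hF : F ∈ Γ.forests) :
    IsDivergingForest F := by
  classical exact (Finset.mem_filter.1 hF).2

theorem exists_forest_card_roots_eq_forestDimension :
    ∃ F ∈ Γ.forests, (forestRoots F).card = Γ.forestDimension := by
  refine Nat.sInf_mem (s := {r : ℕ | ∃ F ∈ Γ.forests, (forestRoots F).card = r}) ⟨_, ∅, ?_, rfl⟩
  simp only [forests, Finset.mem_filter, Finset.empty_mem_powerset, true_and]
  refine ⟨fun w hw => ?_, fun w => by simp [indegree]⟩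
  obtain ⟨b, _, hb⟩ := Relation.TransGen.tail'_iff.1 hw
  simp [ArcIn] at hb

theorem forestsCard_succ_maximum :
    Γ.forestsCard (Fintype.card V - Γ.forestDimension + 1) = ∅ := by
  refine Finset.filter_eq_empty_iff.2 fun F hF hcard => ?_
  have h₁ := card_add_card_forestRoots (Γ.isDivergingForest_of_mem_forests hF)
  have h₂ : Γ.forestDimension ≤ (forestRoots F).card := Nat.sInf_le ⟨F, hF, rfl⟩
  omega

theorem setWeight_maximum_pos :
    0 < Γ.setWeight (Γ.forestsCard (Fintype.card V - Γ.forestDimension)) := by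
  classical
  refine Finset.sum_pos (fun F hF => Finset.prod_pos fun e he => ?_) ?_
  · have hsub := Finset.mem_powerset.1 (Finset.mem_filter.1 (Finset.mem_filter.1 hF).1).1
    exact lt_of_le_of_ne (Γ.weight_nonneg _ _) (Finset.mem_filter.1 (hsub he)).2.symm
  · obtain ⟨F, hF, hr⟩ := Γ.exists_forest_card_roots_eq_forestDimension
    have h₁ := card_add_card_forestRoots (Γ.isDivergingForest_of_mem_forests hF)
    exact ⟨F, Finset.mem_filter.2 ⟨hF, by omega⟩⟩

theorem kirchhoff_mul_normalizedForestMatrix :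
    Γ.kirchhoff * Γ.normalizedForestMatrix = 0 := by
  have h := Γ.forestMatrix_succ (Fintype.card V - Γ.forestDimension)
  have h₀ : Γ.forestMatrix (Fintype.card V - Γ.forestDimension + 1) = 0 := by
    ext i j
    simp [forestMatrix, forestsFromTo, forestsCard_succ_maximum, setWeight]
  rw [h₀, forestsCard_succ_maximum, zero_add] at h
  rw [normalizedForestMatrix, Matrix.mul_smul, h]
  simp [setWeight]

theorem forestMatrix_zero :
    Γ.forestMatrix 0 = Γ.setWeight (Γ.forestsCard 0) • (1 : Matrix V V ℝ) := by
  ext i j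
  rw [forestMatrix_apply, setWeight_forestsCard, Matrix.smul_apply, smul_eq_mul, Finset.sum_mul]
  refine Finset.sum_congr rfl fun F _ => ?_
  by_cases hF : F.card = 0
  · obtain rfl := Finset.card_eq_zero.1 hF
    have hi : indegree (∅ : Finset (V × V)) i = 0 := by simp [indegree]
    by_cases hij : j = i
    · subst hij
      rw [rootIndicator_root_self hi, Matrix.one_apply_eq]
    · rw [rootIndicator_root_ne hi hij, Matrix.one_apply_ne (Ne.symm hij)]
  · simp [weightOfCard, hF]

/-- The complement of the normalized matrix of maximum out forests lies in the column space of the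
Kirchhoff matrix. -/
theorem exists_one_sub_normalizedForestMatrix :
    ∃ X : Matrix V V ℝ, 1 - Γ.normalizedForestMatrix = Γ.kirchhoff * X := by
  have hpos := Γ.setWeight_maximum_pos.ne'
  unfold normalizedForestMatrix
  revert hpos
  generalize Fintype.card V - Γ.forestDimension = k
  intro hpos
  cases k with
  -- Maximum forests without arcs: the normalized matrix is `1`, so `X = 0` works.
  | zero => exact ⟨0, by rw [forestMatrix_zero, smul_smul, inv_mul_cancel₀ hpos]; simp⟩
  | succ k =>
    refine ⟨(Γ.setWeight (Γ.forestsCard (k + 1)))⁻¹ • Γ.forestMatrix k, ?_⟩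
    rw [Matrix.mul_smul, eq_sub_of_add_eq' (Γ.forestMatrix_succ k), smul_sub, smul_smul,
      inv_mul_cancel₀ hpos, one_smul]

end WeightedDigraph

end ForestSum

/-! ### Cesàro limits of stochastic matrices -/

section Limit

variable {V : Type*} [Fintype V] [DecidableEq V] {P : Matrix V V ℝ}

/-- Powers of a stochastic matrix are stochastic, so their entries stay in `[0, 1]`. -/
theorem tendsto_inv_smul_pow_rowStochastic (hP : P ∈ Matrix.rowStochastic ℝ V) :
    Tendsto (fun k : ℕ => (k : ℝ)⁻¹ • P ^ k) atTop (𝓝 0) := by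
  refine tendsto_pi_nhds.2 fun i => tendsto_pi_nhds.2 fun j => ?_
  have hk : ∀ k : ℕ, P ^ k ∈ Matrix.rowStochastic ℝ V := fun k => pow_mem hP k
  refine squeeze_zero (fun k => ?_) (fun k => ?_) (tendsto_inv_atTop_nhds_zero_nat (𝕜 := ℝ))
  · exact mul_nonneg (by positivity) ((Matrix.mem_rowStochastic_iff_sum.1 (hk k)).1 i j)
  · obtain ⟨h₀, h₁⟩ := Matrix.mem_rowStochastic_iff_sum.1 (hk k)
    have : (P ^ k) i j ≤ 1 := by
      rw [← h₁ i]
      exact Finset.single_le_sum (fun m _ => h₀ i m) (Finset.mem_univ j)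
    exact mul_le_of_le_one_right (by positivity) this

/-- A matrix `B` fixed by a stochastic matrix `P` is the Cesàro limit of the powers of `P` if `1 - B`
lies in the column space of `1 - P`. -/
theorem isLimitingMatrix_of_eq (hP : P ∈ Matrix.rowStochastic ℝ V) {B X : Matrix V V ℝ}
    (hB : (1 - P) * B = 0) (hX : 1 - B = (1 - P) * X) : IsLimitingMatrix P B := by
  have hPB : P * B = B := by
    rw [sub_mul, one_mul, sub_eq_zero] at hB
    exact hB.symm
  have hpow : ∀ t : ℕ, P ^ t * B = B := fun t => by
    induction t with
    | zero => simp
    | succ t ih => rw [pow_succ, mul_assoc, hPB, ih]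
  have hsum : ∀ k : ℕ, ∑ t ∈ Finset.range k, P ^ t = (k : ℝ) • B + (1 - P ^ k) * X := fun k => by
    -- Split `1 = B + (1 - B)`: the powers fix `B`, and the factor `1 - P` of `1 - B` makes the
    -- geometric sum telescope.
    calc ∑ t ∈ Finset.range k, P ^ t
        = (∑ t ∈ Finset.range k, P ^ t) * B + (∑ t ∈ Finset.range k, P ^ t) * (1 - B) := by
          rw [← mul_add, add_sub_cancel, mul_one]
      _ = _ := by
          rw [hX, ← mul_assoc, geom_sum_mul_neg, Finset.sum_mul,
            Finset.sum_congr rfl fun t _ => hpow t, Finset.sum_const, Finset.card_range,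
            Nat.cast_smul_eq_nsmul]
  have hlim : Tendsto (fun k : ℕ => B + ((k : ℝ)⁻¹ • (1 : Matrix V V ℝ) - (k : ℝ)⁻¹ • P ^ k) * X)
      atTop (𝓝 (B + ((0 : ℝ) • (1 : Matrix V V ℝ) - 0) * X)) :=
    tendsto_const_nhds.add ((((tendsto_inv_atTop_nhds_zero_nat (𝕜 := ℝ)).smul_const _).sub
      (tendsto_inv_smul_pow_rowStochastic hP)).mul_const X)
  simp only [zero_smul, sub_zero, zero_mul, add_zero] at hlim
  refine hlim.congr' ?_
  filter_upwards [eventually_ne_atTop 0] with k hk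
  rw [hsum, smul_add, smul_smul, inv_mul_cancel₀ (by exact_mod_cast hk), one_smul, ← smul_sub,
    Matrix.smul_mul]

theorem WeightedDigraph.IsRelated.isLimitingMatrix (hP : P ∈ Matrix.rowStochastic ℝ V)
    {Γ : WeightedDigraph V} (h : Γ.IsRelated P) : IsLimitingMatrix P Γ.normalizedForestMatrix := by
  obtain ⟨α, hα, rfl⟩ := h
  obtain ⟨X, hX⟩ := Γ.exists_one_sub_normalizedForestMatrix
  refine isLimitingMatrix_of_eq hP (X := α⁻¹ • X) ?_ ?_
  · rw [sub_sub_cancel, Matrix.smul_mul, Γ.kirchhoff_mul_normalizedForestMatrix, smul_zero]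
  · rw [sub_sub_cancel, hX, Matrix.smul_mul, Matrix.mul_smul, smul_smul, mul_inv_cancel₀ hα,
      one_smul]

theorem WeightedDigraph.isRelated_of_kirchhoff_eq {Γ : WeightedDigraph V} {α : ℝ} (hα : 0 < α)
    (h : Γ.kirchhoff = α⁻¹ • (1 - P)) : Γ.IsRelated P :=
  ⟨α, hα.ne', by rw [h, smul_smul, mul_inv_cancel₀ hα.ne', one_smul, sub_sub_cancel]⟩

/-- The off-diagonal entries of `P`, transposed and scaled, serve as weights; unit row sums force
the diagonal to agree. -/
theorem exists_kirchhoff_eq (hP : P ∈ Matrix.rowStochastic ℝ V) {α : ℝ} (hα : 0 < α) :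
    ∃ Γ : WeightedDigraph V, Γ.kirchhoff = α⁻¹ • (1 - P) := by
  obtain ⟨h₀, h₁⟩ := Matrix.mem_rowStochastic_iff_sum.1 hP
  refine ⟨⟨fun i j => if i = j then 0 else α⁻¹ * P j i, fun i j => ?_, fun i => if_pos rfl⟩, ?_⟩
  · split_ifs
    · exact le_rfl
    · exact mul_nonneg (inv_pos.2 hα).le (h₀ j i)
  · ext i j
    simp only [WeightedDigraph.kirchhoff, Matrix.of_apply, Matrix.smul_apply, Matrix.sub_apply,
      smul_eq_mul]
    by_cases hij : j = i
    · subst hij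
      rw [if_pos rfl, Matrix.one_apply_eq, ← h₁ j, ← Finset.add_sum_erase _ _ (Finset.mem_univ j),
        add_sub_cancel_left, Finset.mul_sum]
      exact Finset.sum_congr rfl fun k hk => if_neg (Finset.ne_of_mem_erase hk)
    · rw [if_neg hij, if_neg hij, Matrix.one_apply_ne (Ne.symm hij)]
      ring

end Limit

theorem theorem6 {V : Type*} [Fintype V] [DecidableEq V] (P : Matrix V V ℝ)
    (hP : P ∈ Matrix.rowStochastic ℝ V) :
    (∀ Γ : WeightedDigraph V, Γ.IsRelated P → IsLimitingMatrix P Γ.normalizedForestMatrix) ∧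
    ∃ B : Matrix V V ℝ, IsLimitingMatrix P B ∧
      ∀ α : ℝ, 0 < α →
        (∃ Γ : WeightedDigraph V, Γ.kirchhoff = α⁻¹ • (1 - P)) ∧
        ∀ Γ : WeightedDigraph V, Γ.kirchhoff = α⁻¹ • (1 - P) →
          B = Γ.normalizedForestMatrix := by
  obtain ⟨Γ₁, hΓ₁⟩ := exists_kirchhoff_eq hP one_pos
  have hB := (WeightedDigraph.isRelated_of_kirchhoff_eq one_pos hΓ₁).isLimitingMatrix hP
  refine ⟨fun Γ h => h.isLimitingMatrix hP, Γ₁.normalizedForestMatrix, hB, fun α hα =>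
    ⟨exists_kirchhoff_eq hP hα, fun Γ h => ?_⟩⟩
  -- The limit depends on `P` alone, so the reference digraph `Γ₁`, built with `α = 1`, gives the
  -- same matrix as any other.
  exact tendsto_nhds_unique hB
    ((WeightedDigraph.isRelated_of_kirchhoff_eq hα h).isLimitingMatrix hP)
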